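/- Let $(q_n)_{n\ge 0}$ be a sequence of integers with $q_n>1$, and let $a_{n,i}\ge 0$ ($n\ge 0$, $1\le i<q_n$) be integers. Define finite words over $\{0,1\}$ by $v_0=0$ and $$v_{n+1}=v_n1^{a_{n,1}}v_n1^{a_{n,2}}v_n\cdots v_n1^{a_{n,q_n-1}}v_n .$$ Let $V$ be the infinite word of which every $v_n$ is an initial segment, let $X$ be the set of all $x\in\{0,1\}^{\mathbb Z}$ such that every finite subword of $x$ is a subword of $V$, and let $T$ be the left shift on $X$. Assume that $X$ is infinite. The spacer parameter is called bounded if there is $B$ with $a_{n,i}\le B$ for all $n$ and $1\le i<q_n$, and unbounded otherwise. A topological dynamical system is a compact metrizable space with a continuous self-map. A factor map is a continuous surjection $\varphi$ from one system to another that intertwines the two self-maps; its target is then called a factor of its source. A system $(Y,S)$ is equicontinuous if $S$ is a homeomorphism and the family $(S^l)_{l\in\mathbb Z}$ is uniformly equicontinuous with respect to a compatible metric. The maximal equicontinuous factor of $(X,T)$ is an equicontinuous factor $(Y,S)$ with a factor map $\varphi:X\to Y$ such that every factor map $\psi$ from $(X,T)$ onto an equicontinuous system $(Y',S')$ has the form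 $\psi=\theta\circ\varphi$ for a factor map $\theta$ from $(Y,S)$ to $(Y',S')$. For $p\ge 1$, $\mathbb Z/p\mathbb Z$ stands for the system $(\mathbb Z/p\mathbb Z,\ x\mapsto x+1)$. Then the following hold. (1) If the spacer parameter is unbounded, then the maximal equicontinuous factor of $(X,T)$ is the one-point system. (2) If the spacer parameter is bounded, then there is a largest integer $p$ for which there is $n\ge 0$ such that $p$ divides $|v_n|+a_{m,i}$ for all $m\ge n$ and all $1\le i<q_m$. Denote it by $p_{\max}$. The maximal equicontinuous factor of $(X,T)$ is $\mathbb Z/p_{\max}\mathbb Z$. It is also the largest finite factor of $(X,T)$: it is a finite factor of $(X,T)$, and every finite factor of $(X,T)$ is a factor of it. (3) In particular, no infinite odometer is a factor of $(X,T)$. Here the odometer given by positive integers $s_0\mid s_1\mid s_2\mid\cdots$ is the inverse limit $\varprojlim_k\mathbb Z/s_k\mathbb Z$ with the map $x\mapsto x+1$. -/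

import Mathlib

universe u v w

namespace RankOne

/-! ### Topological dynamical systems -/

/-- `(Y, S)` is a topological dynamical system: `Y` is a compact metrizable space and `S` is a
continuous self-map of `Y`. -/
structure IsSystem {Y : Type*} [TopologicalSpace Y] (S : Y → Y) : Prop where
  compact : CompactSpace Y
  metrizable : TopologicalSpace.MetrizableSpace Y
  continuous : Continuous S

/-- `φ` is a factor map from `(X, T)` to `(Y, S)`. -/
structure IsFactorMap {X Y : Type*} [TopologicalSpace X] [TopologicalSpace Y]
    (T : X → X) (S : Y → Y) (φ : X → Y) : Prop where
  continuous : Continuous φ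
  surjective : Function.Surjective φ
  comm : ∀ x, φ (T x) = S (φ x)

/-- `(Y, S)` is a factor of `(X, T)`. -/
def IsFactor {X Y : Type*} [TopologicalSpace X] [TopologicalSpace Y]
    (T : X → X) (S : Y → Y) : Prop :=
  ∃ φ : X → Y, IsFactorMap T S φ

/-- `(Y, S)` is equicontinuous: `S` is a homeomorphism and its integer powers are uniformly
equicontinuous for a metric that induces the topology of `Y`. (On a compact space the choice of
the compatible metric does not matter.) -/
def IsEquicontinuous {Y : Type*} [tY : TopologicalSpace Y] (S : Y → Y) : Prop :=
  ∃ e : Y ≃ₜ Y, (∀ y, e y = S y) ∧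
    ∃ d : MetricSpace Y, d.toUniformSpace.toTopologicalSpace = tY ∧
      ∀ ε : ℝ, 0 < ε → ∃ δ : ℝ, 0 < δ ∧ ∀ y₁ y₂ : Y, d.dist y₁ y₂ < δ →
        ∀ l : ℤ, d.dist ((e ^ l) y₁) ((e ^ l) y₂) < ε

/-- `(Y, S)` is the maximal equicontinuous factor of `(X, T)`: it is an equicontinuous factor,
and every factor map from `(X, T)` onto an equicontinuous system factors through it. -/
def IsMaximalEquicontinuousFactor {X : Type u} {Y : Type v}
    [TopologicalSpace X] [TopologicalSpace Y] (T : X → X) (S : Y → Y) : Prop :=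
  IsSystem S ∧ IsEquicontinuous S ∧
    ∃ φ : X → Y, IsFactorMap T S φ ∧
      ∀ (Y' : Type w) [TopologicalSpace Y'] (S' : Y' → Y') (ψ : X → Y'),
        IsSystem S' → IsEquicontinuous S' → IsFactorMap T S' ψ →
          ∃ θ : Y → Y', IsFactorMap S S' θ ∧ ∀ x, θ (φ x) = ψ x

/-- `(Y, S)` is the largest finite factor of `(X, T)`: it is a finite factor, and every finite
factor of `(X, T)` is a factor of `(Y, S)`. -/
def IsLargestFiniteFactor {X : Type u} {Y : Type v}
    [TopologicalSpace X] [TopologicalSpace Y] (T : X → X) (S : Y → Y) : Prop :=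
  IsSystem S ∧ Finite Y ∧ IsFactor T S ∧
    ∀ (Y' : Type w) [TopologicalSpace Y'] (S' : Y' → Y'),
      IsSystem S' → Finite Y' → IsFactor T S' → IsFactor S S'

/-- The cyclic system `ℤ/pℤ` with `x ↦ x + 1` (with the discrete topology). -/
def cyclicMap (p : ℕ) : ZMod p → ZMod p := fun x => x + 1

/-- The odometer given by `s 0 ∣ s 1 ∣ s 2 ∣ ⋯`: the inverse limit of the cyclic groups
`ℤ/(s k)ℤ`, as a subspace of their product. -/
def Odometer (s : ℕ → ℕ) (hs : ∀ k, s k ∣ s (k + 1)) : Set (∀ k, ZMod (s k)) :=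
  {x | ∀ k, ZMod.castHom (hs k) (ZMod (s k)) (x (k + 1)) = x k}

/-- The map `x ↦ x + 1` of an odometer. -/
def odometerMap (s : ℕ → ℕ) (hs : ∀ k, s k ∣ s (k + 1)) :
    Odometer s hs → Odometer s hs :=
  fun x => ⟨fun k => x.1 k + 1, fun k => by
    have h := x.2 k
    rw [map_add, map_one, h]⟩

/-! ### Rank-one subshifts -/

/-- The rank-one generating sequence with cutting parameter `q` and spacer parameter `a`:
`v 0 = 0` and `v (n + 1) = v n 1^(a n 1) v n 1^(a n 2) v n ⋯ v n 1^(a n (q n - 1)) v n`.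
Only the values `a n i` with `1 ≤ i < q n` are used. -/
def genWord (q : ℕ → ℕ) (a : ℕ → ℕ → ℕ) : ℕ → List (Fin 2)
  | 0 => [0]
  | n + 1 => genWord q a n ++
      (List.range (q n - 1)).flatMap fun i =>
        List.replicate (a n (i + 1)) 1 ++ genWord q a n

theorem genWord_prefix_succ (q : ℕ → ℕ) (a : ℕ → ℕ → ℕ) (n : ℕ) :
    genWord q a n <+: genWord q a (n + 1) :=
  List.prefix_append _ _

theorem genWord_prefix (q : ℕ → ℕ) (a : ℕ → ℕ → ℕ) {n m : ℕ} (h : n ≤ m) :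
    genWord q a n <+: genWord q a m := by
  induction m, h using Nat.le_induction with
  | base => exact List.prefix_rfl
  | succ m _ ih => exact ih.trans (genWord_prefix_succ q a m)

theorem lt_length_genWord (q : ℕ → ℕ) (a : ℕ → ℕ → ℕ) (hq : ∀ n, 1 < q n) (n : ℕ) :
    n < (genWord q a n).length := by
  induction n with
  | zero => simp [genWord]
  | succ n ih =>
    obtain ⟨r, hr⟩ : ∃ r, q n - 1 = r + 1 := ⟨q n - 2, by have := hq n; omega⟩
    rw [genWord, hr, List.range_succ]
    simp only [List.length_append, List.flatMap_append, List.flatMap_cons, List.flatMap_nil,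
      List.length_replicate, List.length_nil]
    omega

/-- The infinite rank-one word `V`, the limit of the words `v n`; see `infiniteWord_eq`. -/
def infiniteWord (q : ℕ → ℕ) (a : ℕ → ℕ → ℕ) (k : ℕ) : Fin 2 :=
  (genWord q a k).getD k 0

/-- `V k` is the `k`-th letter of every `v n` that is longer than `k`. -/
theorem infiniteWord_eq (q : ℕ → ℕ) (a : ℕ → ℕ → ℕ) (hq : ∀ n, 1 < q n) (n k : ℕ)
    (h : k < (genWord q a n).length) : infiniteWord q a k = (genWord q a n)[k] := by
  have hk := lt_length_genWord q a hq k
  rw [infiniteWord, List.getD_eq_getElem _ _ hk]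
  rcases le_total k n with hkn | hkn
  · exact (genWord_prefix q a hkn).getElem hk
  · exact ((genWord_prefix q a hkn).getElem h).symm

/-- The rank-one subshift `X_V`: all `x : ℤ → {0, 1}` every finite subword of which is a subword
of `V`. It carries the subspace topology of the product topology. -/
def Subshift (q : ℕ → ℕ) (a : ℕ → ℕ → ℕ) : Set (ℤ → Fin 2) :=
  {x | ∀ (k : ℤ) (l : ℕ), ∃ j : ℕ, ∀ i < l, x (k + i) = infiniteWord q a (j + i)}

/-- The left shift `T x n = x (n + 1)` on the rank-one subshift. -/
def shift (q : ℕ → ℕ) (a : ℕ → ℕ → ℕ) : Subshift q a → Subshift q a :=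
  fun x => ⟨fun n => x.1 (n + 1), fun k l => by
    obtain ⟨j, hj⟩ := x.2 (k + 1) l
    refine ⟨j, fun i hi => ?_⟩
    have h := hj i hi
    rwa [add_right_comm] at h⟩

/-- The spacer parameter is bounded. -/
def BoundedSpacers (q : ℕ → ℕ) (a : ℕ → ℕ → ℕ) : Prop :=
  ∃ B : ℕ, ∀ n i, 1 ≤ i → i < q n → a n i ≤ B

/-- There is `n` such that `p` divides `|v n| + a m i` for all `m ≥ n` and `1 ≤ i < q m`. -/
def DividesLengths (q : ℕ → ℕ) (a : ℕ → ℕ → ℕ) (p : ℕ) : Prop :=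
  ∃ n, ∀ m, n ≤ m → ∀ i, 1 ≤ i → i < q m → p ∣ (genWord q a n).length + a m i

end RankOne

/-! Number the zeros of V from 0 and let z_n be the number of zeros of v_n. For k ≥ 1 the run of
ones before zero number k is a spacer of stage m, where m is largest with z_m ∣ k. So the gaps at
indices not divisible by z_n depend only on the index mod z_n, and the gaps at positive multiples of
z_n are the spacers of all stages ≥ n. The latter are never constant, since otherwise V would be
periodic and X finite (`exists_gap_ne`).

Unbounded spacers: X contains the fixed point 1^∞. A dense orbit comes close to it, and in an
equicontinuous factor the images then stay close forever, so the factor is a point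
(`subsingleton_of_fixed`).

Bounded spacers, cyclic factors: if p divides every |v_n| + spacer of stage ≥ n, the copies of v_n
start at multiples of p. A long subword of V reveals the indices of its zeros mod z_n: were two
readings out of phase, the nonconstant gaps at multiples of z_n in one would equal gaps from a
single nonzero residue class in the other, which are constant. Hence the position mod p is a
continuous function on X (`exists_recognizability`).

Bounded spacers, upper bound: in an equicontinuous factor, every |v_n| + spacer is an ε-period of a
base point once n is large (`exists_approx_period`). Two different ones differ by an approximate
period between 1 and B; these are finitely many candidates, so one of them is an exact period. On
the resulting finite orbit small ε-periods are periods, so the minimal period divides every |v_n| +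
spacer, hence divides p_max (`exists_period`). Density of the base orbit then factors the map
through ℤ/p_max.

Finite factors are equicontinuous, and an infinite odometer would have arbitrarily large cyclic
factors. -/

namespace RankOne

/-! ### Spacers indexed by the zeros of V -/

section Gaps

/-- The number of zeros of `v n`. -/
def zeroCount (q : ℕ → ℕ) (n : ℕ) : ℕ := ∏ k ∈ Finset.range n, q k

theorem zeroCount_succ (q : ℕ → ℕ) (n : ℕ) : zeroCount q (n + 1) = zeroCount q n * q n :=
  Finset.prod_range_succ _ _

theorem zeroCount_dvd (q : ℕ → ℕ) {n m : ℕ} (h : n ≤ m) : zeroCount q n ∣ zeroCount q m :=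
  Finset.prod_dvd_prod_of_subset _ _ _ (Finset.range_mono h)

theorem lt_zeroCount {q : ℕ → ℕ} (hq : ∀ n, 1 < q n) (n : ℕ) : n < zeroCount q n := by
  induction n with
  | zero => simp [zeroCount]
  | succ n ih =>
    rw [zeroCount_succ]
    have := hq n
    nlinarith

theorem zeroCount_pos {q : ℕ → ℕ} (hq : ∀ n, 1 < q n) (n : ℕ) : 0 < zeroCount q n :=
  (Nat.zero_le n).trans_lt (lt_zeroCount hq n)

/-- The largest `m` for which `zeroCount q m` divides `k`. -/
def level (q : ℕ → ℕ) (k : ℕ) : ℕ := Nat.findGreatest (fun m => zeroCount q m ∣ k) k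

/-- The number of ones between the zeros number `k - 1` and `k` of `V`. -/
def gap (q : ℕ → ℕ) (a : ℕ → ℕ → ℕ) (k : ℕ) : ℕ :=
  a (level q k) (k / zeroCount q (level q k) % q (level q k))

theorem gap_eq {q : ℕ → ℕ} (hq : ∀ n, 1 < q n) (a : ℕ → ℕ → ℕ) {m k : ℕ}
    (h : zeroCount q m ∣ k) (h' : ¬ zeroCount q (m + 1) ∣ k) :
    gap q a k = a m (k / zeroCount q m % q m) := by
  have hk : 0 < k := Nat.pos_of_ne_zero fun h0 => h' (h0 ▸ dvd_zero _)
  -- As `m < zeroCount q m`, the search bound `k` in `level` cuts off no candidate.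
  have hm : m ≤ k := (lt_zeroCount hq m).le.trans (Nat.le_of_dvd hk h)
  have : level q k = m :=
    Nat.findGreatest_eq_iff.2 ⟨hm, fun _ => h, fun n hn _ hd =>
      h' ((zeroCount_dvd q hn).trans hd)⟩
  rw [gap, this]

/-- A number that is not divisible by `zeroCount q n` has a level below `n`. -/
theorem exists_level {q : ℕ → ℕ} {n k : ℕ} (h : ¬ zeroCount q n ∣ k) :
    ∃ m < n, zeroCount q m ∣ k ∧ ¬ zeroCount q (m + 1) ∣ k := by
  induction n with
  | zero => simp [zeroCount] at h
  | succ n ih =>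
    by_cases hn : zeroCount q n ∣ k
    · exact ⟨n, n.lt_succ_self, hn, h⟩
    · obtain ⟨m, hm, h1⟩ := ih hn
      exact ⟨m, hm.trans n.lt_succ_self, h1⟩

/-- All copies of v_n have the same inner gaps: the level m of `k` is below `n`, so `zeroCount q (m
+ 1)` divides the shift, which changes neither the level nor the digit mod `q m`. -/
theorem gap_add_mul {q : ℕ → ℕ} (hq : ∀ n, 1 < q n) (a : ℕ → ℕ → ℕ) {n k : ℕ}
    (h : ¬ zeroCount q n ∣ k) (j : ℕ) : gap q a (zeroCount q n * j + k) = gap q a k := by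
  obtain ⟨m, hm, h1, h2⟩ := exists_level h
  obtain ⟨c, hc⟩ := zeroCount_dvd q (Nat.succ_le_of_lt hm)
  have hd : zeroCount q (m + 1) ∣ zeroCount q n * j :=
    (zeroCount_dvd q (Nat.succ_le_of_lt hm)).mul_right j
  rw [gap_eq hq a h1 h2, gap_eq hq a ((Nat.dvd_add_right
    ((zeroCount_dvd q m.le_succ).trans hd)).2 h1) fun h => h2 ((Nat.dvd_add_right hd).1 h)]
  have : zeroCount q n * j + k = k + zeroCount q m * (q m * (c * j)) := by
    rw [hc, zeroCount_succ]; ring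
  rw [this, Nat.add_mul_div_left _ _ (zeroCount_pos hq m), Nat.add_mul_mod_self_left]

theorem gap_mul {q : ℕ → ℕ} (hq : ∀ n, 1 < q n) (a : ℕ → ℕ → ℕ) {n i : ℕ}
    (h1 : 1 ≤ i) (h2 : i < q n) : gap q a (zeroCount q n * i) = a n i := by
  rw [gap_eq hq a (dvd_mul_right _ _), Nat.mul_div_cancel_left _ (zeroCount_pos hq n),
    Nat.mod_eq_of_lt h2]
  rw [zeroCount_succ, Nat.mul_dvd_mul_iff_left (zeroCount_pos hq n)]
  exact fun h => absurd (Nat.le_of_dvd h1 h) (by omega)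

/-- With the converse `exists_gap_mul_eq'`, this replaces the two indices of the spacers of stage ≥
n by the single index `j`. -/
theorem exists_gap_mul_eq {q : ℕ → ℕ} (hq : ∀ n, 1 < q n) (a : ℕ → ℕ → ℕ) {n j : ℕ}
    (hj : 1 ≤ j) : ∃ m i, n ≤ m ∧ 1 ≤ i ∧ i < q m ∧ gap q a (zeroCount q n * j) = a m i := by
  have hpos : 0 < zeroCount q n * j := Nat.mul_pos (zeroCount_pos hq n) hj
  obtain ⟨m, -, h1, h2⟩ := exists_level (q := q) (n := zeroCount q n * j)
    (k := zeroCount q n * j) fun h => absurd (Nat.le_of_dvd hpos h) (lt_zeroCount hq _).not_ge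
  refine ⟨m, zeroCount q n * j / zeroCount q m % q m, ?_, ?_, Nat.mod_lt _ (by have := hq m; omega),
    gap_eq hq a h1 h2⟩
  · by_contra hlt
    exact h2 ((zeroCount_dvd q (by omega)).trans (dvd_mul_right _ _))
  · refine Nat.one_le_iff_ne_zero.2 fun h0 => h2 ?_
    rw [zeroCount_succ]
    exact Nat.mul_dvd_of_dvd_div h1 (Nat.dvd_of_mod_eq_zero h0)

theorem exists_gap_mul_eq' {q : ℕ → ℕ} (hq : ∀ n, 1 < q n) (a : ℕ → ℕ → ℕ) {n m i : ℕ}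
    (hm : n ≤ m) (h1 : 1 ≤ i) (h2 : i < q m) :
    ∃ j, 1 ≤ j ∧ gap q a (zeroCount q n * j) = a m i := by
  obtain ⟨c, hc⟩ := zeroCount_dvd q hm
  refine ⟨c * i, ?_, ?_⟩
  · have := zeroCount_pos hq m
    refine Nat.mul_pos (Nat.pos_of_ne_zero ?_) h1
    rintro rfl
    omega
  · rw [← mul_assoc, ← hc, gap_mul hq a h1 h2]

theorem gap_le {q : ℕ → ℕ} (hq : ∀ n, 1 < q n) {a : ℕ → ℕ → ℕ} {B : ℕ}
    (hB : ∀ n i, 1 ≤ i → i < q n → a n i ≤ B) {k : ℕ} (hk : 1 ≤ k) : gap q a k ≤ B := by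
  obtain ⟨m, i, -, h1, h2, h⟩ := exists_gap_mul_eq hq a (n := 0) hk
  rw [zeroCount, Finset.prod_range_zero, one_mul] at h
  exact h ▸ hB m i h1 h2

end Gaps

/-! ### Words given by the gaps between their zeros -/

section SpacedWords

/-- The word with `m + 1` zeros, starting and ending with `0`, in which `f k` ones stand between
the zeros number `k - 1` and `k`. -/
def spacedWord (f : ℕ → ℕ) : ℕ → List (Fin 2)
  | 0 => [0]
  | m + 1 => spacedWord f m ++ (List.replicate (f (m + 1)) 1 ++ [0])

/-- The position of the zero number `k` in `spacedWord f m`. -/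
def zeroPos (f : ℕ → ℕ) : ℕ → ℕ
  | 0 => 0
  | k + 1 => zeroPos f k + 1 + f (k + 1)

theorem zeroPos_strictMono (f : ℕ → ℕ) : StrictMono (zeroPos f) :=
  strictMono_nat_of_lt_succ fun k => by rw [zeroPos]; omega

theorem spacedWord_congr {f g : ℕ → ℕ} {m : ℕ} (h : ∀ k, 1 ≤ k → k ≤ m → f k = g k) :
    spacedWord f m = spacedWord g m := by
  induction m with
  | zero => rfl
  | succ m ih =>
    rw [spacedWord, spacedWord, ih fun k h1 h2 => h k h1 (by omega), h _ (by omega) le_rfl]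

theorem zeroPos_add (f : ℕ → ℕ) (m k : ℕ) :
    zeroPos f (m + k) = zeroPos f m + zeroPos (fun i => f (m + i)) k := by
  induction k with
  | zero => simp [zeroPos]
  | succ k ih => rw [← add_assoc, zeroPos, ih, zeroPos]; simp only [add_assoc]

theorem zeroPos_congr {f g : ℕ → ℕ} {m : ℕ} (h : ∀ k, 1 ≤ k → k ≤ m → f k = g k) :
    zeroPos f m = zeroPos g m := by
  induction m with
  | zero => rfl
  | succ m ih =>
    rw [zeroPos, zeroPos, ih fun k h1 h2 => h k h1 (by omega), h _ (by omega) le_rfl]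

theorem spacedWord_add (f : ℕ → ℕ) (m k : ℕ) :
    spacedWord f (m + 1 + k) = spacedWord f m ++
      (List.replicate (f (m + 1)) 1 ++ spacedWord (fun i => f (m + 1 + i)) k) := by
  induction k with
  | zero => rfl
  | succ k ih => rw [← add_assoc, spacedWord, ih, spacedWord]; simp only [List.append_assoc, add_assoc]

theorem length_spacedWord (f : ℕ → ℕ) (m : ℕ) : (spacedWord f m).length = zeroPos f m + 1 := by
  induction m with
  | zero => rfl
  | succ m ih =>
    rw [spacedWord, zeroPos]
    simp only [List.length_append, ih, List.length_replicate, List.length_cons, List.length_nil]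
    omega

theorem getElem_spacedWord (f : ℕ → ℕ) (m i : ℕ) (h : i < (spacedWord f m).length) :
    (spacedWord f m)[i] = 0 ↔ ∃ k, zeroPos f k = i := by
  induction m with
  | zero =>
    simp only [spacedWord, List.length_cons, List.length_nil, zero_add, Nat.lt_one_iff] at h
    subst h
    simpa [spacedWord] using ⟨0, rfl⟩
  | succ m ih =>
    have hl := length_spacedWord f m
    have hl' := length_spacedWord f (m + 1)
    have hz : zeroPos f (m + 1) = zeroPos f m + 1 + f (m + 1) := rfl
    simp only [spacedWord]
    rcases lt_or_ge i (spacedWord f m).length with hi | hi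
    · rw [List.getElem_append_left hi, ih hi]
    · rw [List.getElem_append_right hi]
      rcases lt_or_ge (i - (spacedWord f m).length) (List.replicate (f (m + 1)) (1 : Fin 2)).length
        with hj | hj
      · rw [List.getElem_append_left hj, List.getElem_replicate]
        refine iff_of_false (by decide) ?_
        rintro ⟨k, hk⟩
        rw [List.length_replicate] at hj
        rcases le_or_gt k m with h' | h'
        · have := (zeroPos_strictMono f).monotone h'
          omega
        · have := (zeroPos_strictMono f).monotone (Nat.succ_le_of_lt h')
          rw [Nat.succ_eq_add_one] at this
          omega
      · rw [List.getElem_append_right hj, List.getElem_singleton]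
        rw [List.length_replicate] at hj
        exact iff_of_true rfl ⟨m + 1, by omega⟩

end SpacedWords

/-! ### V as a concatenation of copies of v_n -/

section Word

theorem genWord_eq_spacedWord {q : ℕ → ℕ} (hq : ∀ n, 1 < q n) (a : ℕ → ℕ → ℕ)
    (n : ℕ) :
    genWord q a n = spacedWord (gap q a) (zeroCount q n - 1) := by
  induction n with
  | zero => rfl
  | succ n ih =>
    -- The induction runs over initial segments of v_(n+1) made of `r + 1` copies of v_n.
    have key : ∀ r, r < q n → genWord q a n ++ ((List.range r).flatMap fun i =>
        List.replicate (a n (i + 1)) 1 ++ genWord q a n) =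
          spacedWord (gap q a) (zeroCount q n * (r + 1) - 1) := by
      intro r
      induction r with
      | zero => intro _; simp [ih]
      | succ r ihr =>
        intro hr
        have hz := zeroCount_pos hq n
        have e : zeroCount q n * (r + 1 + 1) - 1 =
            (zeroCount q n * (r + 1) - 1) + 1 + (zeroCount q n - 1) := by
          rw [mul_add _ (r + 1), mul_one]
          have : 0 < zeroCount q n * (r + 1) := by positivity
          omega
        have e' : zeroCount q n * (r + 1) - 1 + 1 = zeroCount q n * (r + 1) :=
          Nat.sub_add_cancel (Nat.mul_pos hz r.succ_pos)
        rw [List.range_succ, List.flatMap_append, ← List.append_assoc, ihr (by omega), e,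
          spacedWord_add, e', gap_mul hq a (by omega) hr, List.flatMap_singleton, ih]
        congr 2
        refine spacedWord_congr fun k h1 h2 => (gap_add_mul hq a ?_ _).symm
        exact fun h => absurd (Nat.le_of_dvd h1 h) (by omega)
    rw [genWord, key _ (by have := hq n; omega), zeroCount_succ,
      Nat.sub_add_cancel (hq n).le]

theorem length_genWord {q : ℕ → ℕ} (hq : ∀ n, 1 < q n) (a : ℕ → ℕ → ℕ)
    (n : ℕ) :
    (genWord q a n).length = zeroPos (gap q a) (zeroCount q n - 1) + 1 := by
  rw [genWord_eq_spacedWord hq, length_spacedWord]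

theorem infiniteWord_eq_zero_iff {q : ℕ → ℕ} (hq : ∀ n, 1 < q n) (a : ℕ → ℕ → ℕ)
    (i : ℕ) :
    infiniteWord q a i = 0 ↔ ∃ k, zeroPos (gap q a) k = i := by
  have h := lt_length_genWord q a hq i
  rw [infiniteWord_eq q a hq i i h]
  simp only [genWord_eq_spacedWord hq a]
  exact getElem_spacedWord _ _ _ _

theorem infiniteWord_eq_iff {q : ℕ → ℕ} (hq : ∀ n, 1 < q n) (a : ℕ → ℕ → ℕ)
    (i j : ℕ) : infiniteWord q a i = infiniteWord q a j ↔
    ((∃ k, zeroPos (gap q a) k = i) ↔ ∃ k, zeroPos (gap q a) k = j) := by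
  rw [← infiniteWord_eq_zero_iff hq, ← infiniteWord_eq_zero_iff hq]
  generalize infiniteWord q a i = x
  generalize infiniteWord q a j = y
  revert x y
  decide

theorem zeroPos_mul_add {q : ℕ → ℕ} (hq : ∀ n, 1 < q n) (a : ℕ → ℕ → ℕ)
    (n j : ℕ) {k : ℕ} (hk : k < zeroCount q n) :
    zeroPos (gap q a) (zeroCount q n * j + k) =
      zeroPos (gap q a) (zeroCount q n * j) + zeroPos (gap q a) k := by
  rw [zeroPos_add]
  congr 1
  refine zeroPos_congr fun i h1 h2 => gap_add_mul hq a ?_ _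
  exact fun h => absurd (Nat.le_of_dvd h1 h) (by omega)

theorem zeroPos_mul_succ {q : ℕ → ℕ} (hq : ∀ n, 1 < q n) (a : ℕ → ℕ → ℕ)
    (n j : ℕ) : zeroPos (gap q a) (zeroCount q n * (j + 1)) =
    zeroPos (gap q a) (zeroCount q n * j) +
      ((genWord q a n).length + gap q a (zeroCount q n * (j + 1))) := by
  have hz := zeroCount_pos hq n
  have e : zeroCount q n * (j + 1) = zeroCount q n * j + (zeroCount q n - 1) + 1 := by
    rw [mul_add, mul_one]
    omega
  rw [length_genWord hq, e, zeroPos, ← e, zeroPos_mul_add hq a n j (by omega)]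
  omega

/-- The copies of `v n` of which `V` is built. -/
theorem infiniteWord_block {q : ℕ → ℕ} (hq : ∀ n, 1 < q n) (a : ℕ → ℕ → ℕ)
    (n j : ℕ) {i : ℕ} (hi : i < (genWord q a n).length) :
    infiniteWord q a (zeroPos (gap q a) (zeroCount q n * j) + i) = infiniteWord q a i := by
  have hz := zeroCount_pos hq n
  have hm := zeroPos_strictMono (gap q a)
  rw [length_genWord hq] at hi
  rw [infiniteWord_eq_iff hq]
  constructor
  · rintro ⟨k, hk⟩
    have h1 : zeroCount q n * j ≤ k := hm.le_iff_le.1 (by omega)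
    obtain ⟨t, rfl⟩ := Nat.exists_eq_add_of_le h1
    have h2 : t < zeroCount q n := by
      by_contra hlt
      have h3 := hm.lt_iff_lt.2 (show zeroCount q n * j + (zeroCount q n - 1) <
        zeroCount q n * j + t by omega)
      rw [zeroPos_mul_add hq a n j (show zeroCount q n - 1 < zeroCount q n by omega)] at h3
      omega
    rw [zeroPos_mul_add hq a n j h2] at hk
    exact ⟨t, by omega⟩
  · rintro ⟨k, rfl⟩
    have h2 : k ≤ zeroCount q n - 1 := hm.le_iff_le.1 (by omega)
    exact ⟨zeroCount q n * j + k, zeroPos_mul_add hq a n j (by omega)⟩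

/-- `V` is recurrent. -/
theorem infiniteWord_recurrent {q : ℕ → ℕ} (hq : ∀ n, 1 < q n) (a : ℕ → ℕ → ℕ)
    (l : ℕ) :
    ∃ r, 0 < r ∧ ∀ i < l, infiniteWord q a (r + i) = infiniteWord q a i := by
  refine ⟨zeroPos (gap q a) (zeroCount q l * 1), ?_, fun i hi =>
    infiniteWord_block hq a l 1 (hi.trans (lt_length_genWord q a hq l))⟩
  exact (zeroPos_strictMono (gap q a)) (a := 0) (by have := zeroCount_pos hq l; omega)

theorem dvd_length_iff {q : ℕ → ℕ} (hq : ∀ n, 1 < q n) (a : ℕ → ℕ → ℕ)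
    {p n : ℕ} :
    (∀ m, n ≤ m → ∀ i, 1 ≤ i → i < q m → p ∣ (genWord q a n).length + a m i) ↔
      ∀ j, 1 ≤ j → p ∣ (genWord q a n).length + gap q a (zeroCount q n * j) := by
  constructor
  · intro h j hj
    obtain ⟨m, i, h1, h2, h3, e⟩ := exists_gap_mul_eq hq a (n := n) hj
    exact e ▸ h m h1 i h2 h3
  · intro h m h1 i h2 h3
    obtain ⟨j, hj, e⟩ := exists_gap_mul_eq' hq a h1 h2 h3
    exact e ▸ h j hj

theorem dvd_zeroPos {q : ℕ → ℕ} (hq : ∀ n, 1 < q n) (a : ℕ → ℕ → ℕ)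
    {p n : ℕ}
    (h : ∀ j, 1 ≤ j → p ∣ (genWord q a n).length + gap q a (zeroCount q n * j)) (j : ℕ) :
    p ∣ zeroPos (gap q a) (zeroCount q n * j) := by
  induction j with
  | zero => exact dvd_zero _
  | succ j ih =>
    rw [zeroPos_mul_succ hq]
    exact dvd_add ih (h _ (by omega))

/-- A spaced copy of v_m runs between two starts of copies of v_n, and `p` divides both positions.
-/
theorem dvd_length_mono {q : ℕ → ℕ} (hq : ∀ n, 1 < q n) (a : ℕ → ℕ → ℕ)
    {p n m : ℕ} (hnm : n ≤ m)
    (h : ∀ j, 1 ≤ j → p ∣ (genWord q a n).length + gap q a (zeroCount q n * j)) :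
    ∀ j, 1 ≤ j → p ∣ (genWord q a m).length + gap q a (zeroCount q m * j) := by
  intro j hj
  obtain ⟨c, hc⟩ := zeroCount_dvd q hnm
  obtain ⟨j, rfl⟩ := Nat.exists_eq_add_of_le' hj
  have h1 := dvd_zeroPos hq a h (c * j)
  have h2 := dvd_zeroPos hq a h (c * (j + 1))
  rw [← mul_assoc, ← hc] at h1 h2
  rw [zeroPos_mul_succ hq] at h2
  exact (Nat.dvd_add_right h1).1 h2

end Word


/-! ### Reading the phase from a long subword -/

section Recognizability

/-- If the words `v n` are separated by a constant number of ones, then `V` is periodic and the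
subshift is finite. -/
theorem exists_gap_ne {q : ℕ → ℕ} (hq : ∀ n, 1 < q n) (a : ℕ → ℕ → ℕ)
    (hX : Infinite (Subshift q a)) (n : ℕ) :
    ∃ j₁ j₂, 1 ≤ j₁ ∧ 1 ≤ j₂ ∧
      gap q a (zeroCount q n * j₁) ≠ gap q a (zeroCount q n * j₂) := by
  by_contra! hcon
  have hz := zeroCount_pos hq n
  set h := zeroPos (gap q a) (zeroCount q n) with hh
  have hpos : 0 < h := zeroPos_strictMono (gap q a) (a := 0) hz
  -- Inner gaps always repeat with period `zeroCount q n`; the assumed constancy covers the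
  -- multiples too. Hence V has period `h`.
  have hgap : ∀ k, 1 ≤ k → gap q a (zeroCount q n + k) = gap q a k := by
    intro k hk
    by_cases hd : zeroCount q n ∣ k
    · obtain ⟨c, rfl⟩ := hd
      have hc : 1 ≤ c := Nat.pos_of_mul_pos_left hk
      rw [show zeroCount q n + zeroCount q n * c = zeroCount q n * (c + 1) by ring]
      exact hcon _ _ (by omega) hc
    · simpa using gap_add_mul hq a hd 1
  have hP : ∀ k, zeroPos (gap q a) (zeroCount q n + k) = h + zeroPos (gap q a) k := fun k => by
    rw [zeroPos_add]
    exact congrArg _ (zeroPos_congr fun i h1 _ => hgap i h1)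
  have hV : ∀ i, infiniteWord q a (i + h) = infiniteWord q a i := by
    intro i
    rw [infiniteWord_eq_iff hq]
    constructor
    · rintro ⟨k, hk⟩
      have : zeroCount q n ≤ k := (zeroPos_strictMono (gap q a)).le_iff_le.1 (by omega)
      obtain ⟨t, rfl⟩ := Nat.exists_eq_add_of_le this
      rw [hP] at hk
      exact ⟨t, by omega⟩
    · rintro ⟨k, rfl⟩
      exact ⟨zeroCount q n + k, by rw [hP, add_comm]⟩
  have hper : ∀ x : Subshift q a, Function.Periodic x.1 (h : ℤ) := by
    intro x k
    obtain ⟨j, hj⟩ := x.2 k (h + 1)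
    rw [hj h (by omega), hV]
    simpa using (hj 0 (by omega)).symm
  have hinj : Function.Injective fun (x : Subshift q a) (i : Fin h) => x.1 i := by
    intro x y hxy
    refine Subtype.ext (funext fun k => ?_)
    have h0 : (0 : ℤ) < h := by exact_mod_cast hpos
    have e : ∀ x : Subshift q a, x.1 k = x.1 (k % h) := fun x => by
      rw [Int.emod_def, mul_comm]
      exact ((hper x).sub_int_mul_eq _).symm
    have h1 := congrFun hxy ⟨(k % h).toNat, by have := Int.emod_lt_of_pos k h0; omega⟩
    simp only [Int.toNat_of_nonneg (Int.emod_nonneg k h0.ne')] at h1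
    rw [e, e, h1]
  exact hX.not_finite (Finite.of_injective _ hinj)

theorem gap_mod {q : ℕ → ℕ} (hq : ∀ n, 1 < q n) (a : ℕ → ℕ → ℕ)
    {n k : ℕ} (h : ¬ zeroCount q n ∣ k) :
    gap q a (k % zeroCount q n) = gap q a k := by
  conv_rhs => rw [← Nat.div_add_mod k (zeroCount q n)]
  exact (gap_add_mul hq a (by rwa [Nat.dvd_mod_iff dvd_rfl]) _).symm

theorem exists_first_zero {q : ℕ → ℕ} {a : ℕ → ℕ → ℕ}
    {B : ℕ} (hB : ∀ k, 1 ≤ k → gap q a k ≤ B) (j : ℕ) :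
    ∃ k, j ≤ zeroPos (gap q a) k ∧ zeroPos (gap q a) k ≤ j + B ∧
      ∀ k', j ≤ zeroPos (gap q a) k' → k ≤ k' := by
  have hex : ∃ k, j ≤ zeroPos (gap q a) k := ⟨j, (zeroPos_strictMono _).le_apply⟩
  classical
  refine ⟨Nat.find hex, Nat.find_spec hex, ?_, fun k' h => Nat.find_min' hex h⟩
  rcases hf : Nat.find hex with _ | k
  · simp [zeroPos]
  · have h1 := Nat.find_min hex (show k < Nat.find hex by omega)
    have := hB (k + 1) (by omega)
    rw [zeroPos]
    omega

theorem zeroPos_add_le {q : ℕ → ℕ} {a : ℕ → ℕ → ℕ}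
    {B : ℕ} (hB : ∀ k, 1 ≤ k → gap q a k ≤ B) (k t : ℕ) :
    zeroPos (gap q a) (k + t) ≤ zeroPos (gap q a) k + t * (B + 1) := by
  induction t with
  | zero => simp
  | succ t ih =>
    have := hB (k + t + 1) (by omega)
    rw [← add_assoc, zeroPos, add_mul]
    omega

/-- Zeros at the corresponding positions of two equal subwords of `V`. -/
theorem zeroPos_align {q : ℕ → ℕ} (hq : ∀ n, 1 < q n) {a : ℕ → ℕ → ℕ}
    {B M j j' k k' : ℕ} (hB : ∀ k, 1 ≤ k → gap q a k ≤ B)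
    (hjj : ∀ i < (M + 2) * (B + 1), infiniteWord q a (j + i) = infiniteWord q a (j' + i))
    (h1 : j ≤ zeroPos (gap q a) k) (h2 : zeroPos (gap q a) k ≤ j + B)
    (h3 : ∀ r, j ≤ zeroPos (gap q a) r → k ≤ r)
    (h1' : j' ≤ zeroPos (gap q a) k') (h2' : zeroPos (gap q a) k' ≤ j' + B)
    (h3' : ∀ r, j' ≤ zeroPos (gap q a) r → k' ≤ r) {t : ℕ} (ht : t ≤ M) :
    zeroPos (gap q a) (k + t) + j' = zeroPos (gap q a) (k' + t) + j := by
  have hm := zeroPos_strictMono (gap q a)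
  have hjj' : ∀ i < (M + 2) * (B + 1), (∃ r, zeroPos (gap q a) r = j + i) ↔
    ∃ r, zeroPos (gap q a) r = j' + i := fun i hi => (infiniteWord_eq_iff hq a _ _).1 (hjj i hi)
  -- Zero number `t` after the first one lies at offset at most `B + t * (B + 1)`, so inside the
  -- common window.
  have hL : ∀ t ≤ M, B + t * (B + 1) < (M + 2) * (B + 1) := fun t ht => by nlinarith
  induction t with
  | zero =>
    have := hL 0 (by omega)
    obtain ⟨r, hr⟩ := (hjj' (zeroPos (gap q a) k - j) (by omega)).1 ⟨k, by omega⟩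
    obtain ⟨r', hr'⟩ := (hjj' (zeroPos (gap q a) k' - j') (by omega)).2 ⟨k', by omega⟩
    have e := hm.monotone (h3' r (by omega))
    have e' := hm.monotone (h3 r' (by omega))
    simp only [add_zero]
    omega
  | succ t ih =>
    have ih := ih (by omega)
    have := hL _ ht
    have b := zeroPos_add_le hB k (t + 1)
    have b' := zeroPos_add_le hB k' (t + 1)
    have l := hm (show k + t < k + (t + 1) by omega)
    have l' := hm (show k' + t < k' + (t + 1) by omega)
    have g := hm.monotone (show k ≤ k + t by omega)
    have g' := hm.monotone (show k' ≤ k' + t by omega)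
    -- Transporting the next zero of either subword to the other bounds the next zero there; the two
    -- bounds force equality.
    obtain ⟨r, hr⟩ := (hjj' (zeroPos (gap q a) (k + (t + 1)) - j) (by omega)).1
      ⟨k + (t + 1), by omega⟩
    obtain ⟨r', hr'⟩ := (hjj' (zeroPos (gap q a) (k' + (t + 1)) - j') (by omega)).2
      ⟨k' + (t + 1), by omega⟩
    have c : k' + t < r := hm.lt_iff_lt.1 (by omega)
    have c' : k + t < r' := hm.lt_iff_lt.1 (by omega)
    have e := hm.monotone (show k' + (t + 1) ≤ r by omega)
    have e' := hm.monotone (show k + (t + 1) ≤ r' by omega)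
    omega

/-- The position modulo `p` of a long subword of `V` is determined by the subword. -/
theorem exists_recognizability {q : ℕ → ℕ} (hq : ∀ n, 1 < q n) {a : ℕ → ℕ → ℕ}
    (hX : Infinite (Subshift q a)) (hb : BoundedSpacers q a) {p : ℕ}
    (hp : DividesLengths q a p) :
    ∃ L, ∀ j j', (∀ i < L, infiniteWord q a (j + i) = infiniteWord q a (j' + i)) →
      j ≡ j' [MOD p] := by
  obtain ⟨B, hB⟩ := hb
  replace hB : ∀ k, 1 ≤ k → gap q a k ≤ B := fun k hk => gap_le hq hB hk
  obtain ⟨n, hn⟩ := hp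
  rw [dvd_length_iff hq] at hn
  obtain ⟨j₁, j₂, hj₁, hj₂, hne⟩ := exists_gap_ne hq a hX n
  have hz := zeroCount_pos hq n
  -- Every copy of v_N contains both of the distinct gaps.
  obtain ⟨N, hnN, hN₁, hN₂⟩ : ∃ N, n ≤ N ∧ zeroCount q n * j₁ < zeroCount q N ∧
      zeroCount q n * j₂ < zeroCount q N :=
    ⟨n + zeroCount q n * j₁ + zeroCount q n * j₂,
      by omega, lt_of_le_of_lt (by omega) (lt_zeroCount hq _),
      lt_of_le_of_lt (by omega) (lt_zeroCount hq _)⟩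
  refine ⟨(2 * zeroCount q N + 2) * (B + 1), fun j j' hjj => ?_⟩
  obtain ⟨k, h1, h2, h3⟩ := exists_first_zero hB j
  obtain ⟨k', h1', h2', h3'⟩ := exists_first_zero hB j'
  have hal := fun t (ht : t ≤ 2 * zeroCount q N) =>
    zeroPos_align hq hB hjj h1 h2 h3 h1' h2' h3' ht
  have hg : ∀ t, 1 ≤ t → t ≤ 2 * zeroCount q N → gap q a (k + t) = gap q a (k' + t) := by
    intro t ht ht'
    obtain ⟨t, rfl⟩ := Nat.exists_eq_add_of_le' ht
    have e1 := hal _ ht'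
    have e2 := hal t (by omega)
    rw [← add_assoc, ← add_assoc, zeroPos, zeroPos] at e1
    rw [← add_assoc, ← add_assoc]
    omega
  have hzN := zeroCount_pos hq N
  have hmod : k % zeroCount q n = k' % zeroCount q n := by
    by_contra hk
    -- A copy of v_N starts within `zeroCount q N` zeros after `k`, so it ends within the `2 *
    -- zeroCount q N` compared gaps.
    obtain ⟨s, hs, hs'⟩ : ∃ s, k < zeroCount q N * s ∧ zeroCount q N * s ≤ k + zeroCount q N := by
      refine ⟨k / zeroCount q N + 1, ?_, ?_⟩
      · exact Nat.lt_mul_div_succ k hzN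
      · rw [mul_add, mul_one]
        have := Nat.mul_div_le k (zeroCount q N)
        omega
    -- Out of phase, these gaps sit at indices of one nonzero residue class mod `zeroCount q n` in
    -- the other reading; the right side does not depend on `i`.
    have key : ∀ i, 1 ≤ i → zeroCount q n * i < zeroCount q N →
        gap q a (zeroCount q n * i) =
          gap q a ((zeroCount q N * s - k + k') % zeroCount q n) := by
      intro i hi hi'
      have hpos : 0 < zeroCount q n * i := Nat.mul_pos hz hi
      rw [← gap_add_mul hq a (fun hd => absurd (Nat.le_of_dvd hpos hd) hi'.not_ge) s]
      have e := hg (zeroCount q N * s + zeroCount q n * i - k) (by omega) (by omega)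
      rw [show k + (zeroCount q N * s + zeroCount q n * i - k) =
        zeroCount q N * s + zeroCount q n * i by omega] at e
      rw [e, ← gap_mod hq a (n := n)]
      · congr 1
        rw [show k' + (zeroCount q N * s + zeroCount q n * i - k) =
          zeroCount q N * s - k + k' + zeroCount q n * i by omega, Nat.add_mul_mod_self_left]
      · intro hd
        have hd2 : zeroCount q n ∣ k + (zeroCount q N * s + zeroCount q n * i - k) := by
          rw [show k + (zeroCount q N * s + zeroCount q n * i - k) =
            zeroCount q N * s + zeroCount q n * i by omega]
          exact dvd_add ((zeroCount_dvd q hnN).mul_right _) (dvd_mul_right _ _)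
        exact hk (Nat.ModEq.add_right_cancel' _
          (((Nat.modEq_zero_iff_dvd).2 hd2).trans ((Nat.modEq_zero_iff_dvd).2 hd).symm))
    exact hne ((key j₁ hj₁ hN₁).trans (key j₂ hj₂ hN₂).symm)
  have e0 := hal 0 (by omega)
  simp only [add_zero] at e0
  have hd : ∀ k, zeroPos (gap q a) k ≡ zeroPos (gap q a) (k % zeroCount q n) [MOD p] := by
    intro k
    conv_lhs => rw [← Nat.div_add_mod k (zeroCount q n)]
    rw [zeroPos_mul_add hq a n _ (Nat.mod_lt _ hz)]
    simpa using ((Nat.modEq_zero_iff_dvd).2 (dvd_zeroPos hq a hn (k / zeroCount q n))).add_right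
      (zeroPos (gap q a) (k % zeroCount q n))
  have hkk : zeroPos (gap q a) k ≡ zeroPos (gap q a) k' [MOD p] :=
    (hd k).trans (hmod ▸ (hd k').symm)
  refine (Nat.ModEq.add_left_cancel hkk ?_).symm
  rw [e0]

end Recognizability

/-! ### A two-sided base point built from V -/

section BasePoint

/-- A bi-infinite word `x` that agrees with `V` around positions `c 0 < c 1 < ⋯`. -/
theorem exists_word_of_infiniteWord {q : ℕ → ℕ} (hq : ∀ n, 1 < q n) (a : ℕ → ℕ → ℕ)
    : ∃ (x : ℤ → Fin 2) (c : ℕ → ℕ), StrictMono c ∧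
    ∀ n i, i ≤ 2 * c n → x ((i : ℤ) - c n) = infiniteWord q a i := by
  choose r hr0 hr using infiniteWord_recurrent hq a
  -- The prefix of length `2 * c n + 1` recurs at `c (n + 1) - c n`, so the windows centred at `c n`
  -- and `c (n + 1)` agree where they overlap.
  obtain ⟨c, hc⟩ : ∃ c : ℕ → ℕ, ∀ n, c (n + 1) = c n + r (2 * c n + 1) :=
    ⟨fun n => Nat.rec 0 (fun _ c => c + r (2 * c + 1)) n, fun _ => rfl⟩
  have hmono : StrictMono c := strictMono_nat_of_lt_succ fun n => by
    have := hr0 (2 * c n + 1)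
    rw [hc]
    omega
  have hV : ∀ n d i, i ≤ 2 * c n →
      infiniteWord q a (c (n + d) - c n + i) = infiniteWord q a i := by
    intro n d i hi
    induction d with
    | zero => simp
    | succ d ih =>
      have h1 := hmono.monotone (Nat.le_add_right n d)
      have h2 := hr (2 * c (n + d) + 1) (c (n + d) - c n + i) (by omega)
      rw [← add_assoc, hc, ← ih, ← h2]
      congr 1
      omega
  refine ⟨fun i => infiniteWord q a ((c i.natAbs : ℤ) + i).toNat, c, hmono, fun n i hi => ?_⟩
  simp only
  generalize hm : ((i : ℤ) - c n).natAbs = m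
  have hmc : m ≤ c m := hmono.le_apply
  rcases le_total n m with h | h
  · obtain ⟨d, rfl⟩ := Nat.exists_eq_add_of_le h
    have := hmono.monotone h
    rw [← hV n d i hi]
    congr 1
    omega
  · obtain ⟨d, rfl⟩ := Nat.exists_eq_add_of_le h
    have := hmono.monotone h
    rw [← hV m d (c m + ((i : ℤ) - c (m + d))).toNat (by omega)]
    congr 1
    omega

/-- The orbit of a point of the subshift that agrees with `V` around positions
`c 0 < c 1 < ⋯`. -/
theorem exists_orbit {q : ℕ → ℕ} (hq : ∀ n, 1 < q n) (a : ℕ → ℕ → ℕ)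
    : ∃ (x : ℤ → Subshift q a) (c : ℕ → ℕ), StrictMono c ∧
    (∀ k i, (x k).1 i = (x 0).1 (k + i)) ∧
    ∀ n i, i ≤ 2 * c n → (x 0).1 ((i : ℤ) - c n) = infiniteWord q a i := by
  obtain ⟨x, c, hc, hx⟩ := exists_word_of_infiniteWord hq a
  refine ⟨fun k => ⟨fun i => x (k + i), fun t l => ?_⟩, c, hc, fun k i => ?_, fun n i hi => ?_⟩
  · have hn : (k + t).natAbs + l ≤ c ((k + t).natAbs + l) := hc.le_apply
    refine ⟨(k + t + c ((k + t).natAbs + l)).toNat, fun i hi => ?_⟩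
    rw [← hx ((k + t).natAbs + l) _ (by omega)]
    exact congrArg x (by omega)
  · simp
  · simpa using hx n i hi

end BasePoint


/-! ### Dense orbit, cyclic factors and the fixed point -/

section Topology

variable {q : ℕ → ℕ} {a : ℕ → ℕ → ℕ}

theorem exists_window {U : Set (Subshift q a)} (hU : IsOpen U) {x : Subshift q a} (hx : x ∈ U) :
    ∃ L : ℕ, ∀ y : Subshift q a, (∀ i : ℤ, i.natAbs ≤ L → y.1 i = x.1 i) → y ∈ U := by
  obtain ⟨W, hW, rfl⟩ := isOpen_induced_iff.1 hU
  obtain ⟨I, u, hu, hI⟩ := isOpen_pi_iff.1 hW x.1 hx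
  refine ⟨I.sup Int.natAbs, fun y hy => hI fun i hi => ?_⟩
  rw [hy i (Finset.le_sup (f := Int.natAbs) hi)]
  exact (hu i hi).2

theorem isOpen_of_window {U : Set (Subshift q a)} (L : ℕ)
    (h : ∀ x y : Subshift q a, x ∈ U → (∀ i < L, y.1 (i : ℕ) = x.1 (i : ℕ)) → y ∈ U) :
    IsOpen U := by
  have hc : Continuous fun (x : Subshift q a) (i : Fin L) => x.1 (i : ℕ) :=
    continuous_pi fun i => (continuous_apply _).comp continuous_subtype_val
  have : U = (fun (x : Subshift q a) (i : Fin L) => x.1 (i : ℕ)) ⁻¹'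
      ((fun (x : Subshift q a) (i : Fin L) => x.1 (i : ℕ)) '' U) := by
    refine Set.Subset.antisymm (Set.subset_preimage_image _ _) ?_
    rintro y ⟨x, hx, hxy⟩
    exact h x y hx fun i hi => (congrFun hxy ⟨i, hi⟩).symm
  rw [this]
  exact (isOpen_discrete _).preimage hc

theorem continuous_of_window {Y : Type*} [TopologicalSpace Y] {f : Subshift q a → Y} (L : ℕ)
    (h : ∀ x y : Subshift q a, (∀ i < L, y.1 (i : ℕ) = x.1 (i : ℕ)) → f y = f x) :
    Continuous f :=
  continuous_def.2 fun s _ => isOpen_of_window L fun x y hx hxy => by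
    rw [Set.mem_preimage, h x y hxy]
    exact hx

theorem exists_orbit_window {x : ℤ → Subshift q a} {c : ℕ → ℕ} (hc : StrictMono c)
    (hx : ∀ k i, (x k).1 i = (x 0).1 (k + i))
    (hV : ∀ n i, i ≤ 2 * c n → (x 0).1 ((i : ℤ) - c n) = infiniteWord q a i)
    (y : Subshift q a) (L : ℕ) : ∃ k, ∀ i : ℤ, i.natAbs ≤ L → (x k).1 i = y.1 i := by
  obtain ⟨j, hj⟩ := y.2 (-L) (2 * L + 1)
  have hn : j + 2 * L ≤ c (j + 2 * L) := hc.le_apply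
  refine ⟨j + L - c (j + 2 * L), fun i hi => ?_⟩
  have h1 := hj (i + L).toNat (by omega)
  have h2 := hV (j + 2 * L) (j + (i + L).toNat) (by omega)
  rw [← h2] at h1
  rw [hx, ← (congrArg y.1 (show -(L : ℤ) + ((i + L).toNat : ℕ) = i by omega)), h1]
  exact congrArg _ (by omega)

theorem denseRange_orbit {x : ℤ → Subshift q a} {c : ℕ → ℕ} (hc : StrictMono c)
    (hx : ∀ k i, (x k).1 i = (x 0).1 (k + i))
    (hV : ∀ n i, i ≤ 2 * c n → (x 0).1 ((i : ℤ) - c n) = infiniteWord q a i) :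
    DenseRange x := by
  refine dense_iff_inter_open.2 fun U hU ⟨y, hy⟩ => ?_
  obtain ⟨L, hL⟩ := exists_window hU hy
  obtain ⟨k, hk⟩ := exists_orbit_window hc hx hV y L
  exact ⟨x k, hL _ hk, Set.mem_range_self k⟩

theorem shift_orbit {x : ℤ → Subshift q a} (hx : ∀ k i, (x k).1 i = (x 0).1 (k + i)) (k : ℤ) :
    shift q a (x k) = x (k + 1) := by
  refine Subtype.ext (funext fun i => ?_)
  change (x k).1 (i + 1) = _
  rw [hx k, hx (k + 1)]
  exact congrArg _ (by ring)

theorem nonempty_subshift (hq : ∀ n, 1 < q n) (a : ℕ → ℕ → ℕ) : Nonempty (Subshift q a) :=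
  let ⟨x, _⟩ := exists_orbit hq a
  ⟨x 0⟩

theorem shift_surjective (q : ℕ → ℕ) (a : ℕ → ℕ → ℕ) : Function.Surjective (shift q a) := by
  intro x
  refine ⟨⟨fun n => x.1 (n - 1), fun k l => ?_⟩, Subtype.ext (funext fun n => ?_)⟩
  · obtain ⟨j, hj⟩ := x.2 (k - 1) l
    refine ⟨j, fun i hi => ?_⟩
    rw [← hj i hi]
    exact congrArg x.1 (by ring)
  · exact congrArg x.1 (by ring)

/-- The points of the subshift have a well-defined phase modulo `p` if `p` divides the lengths of
the spaced blocks. -/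
theorem isFactor_cyclicMap (hq : ∀ n, 1 < q n) (hX : Infinite (Subshift q a))
    (hb : BoundedSpacers q a) {p : ℕ} [NeZero p] (hp : DividesLengths q a p) :
    IsFactor (shift q a) (cyclicMap p) := by
  -- `j x` is any place in V where a window of `x` occurs; its class mod `p` is well defined. The
  -- one extra letter allows comparison with the shifted point.
  obtain ⟨L, hL⟩ := exists_recognizability hq hX hb hp
  choose j hj using fun x : Subshift q a => x.2 0 (L + 1)
  simp only [zero_add] at hj
  have hcomm : ∀ x, (j (shift q a x) : ZMod p) = (j x : ZMod p) + 1 := by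
    intro x
    have : j (shift q a x) ≡ j x + 1 [MOD p] := hL _ _ fun i hi => by
      rw [← hj (shift q a x) i (by omega)]
      change x.1 ((i : ℤ) + 1) = _
      have := hj x (i + 1) (by omega)
      push_cast at this
      rw [this]
      congr 1
      omega
    rw [← Nat.cast_succ]
    exact (ZMod.natCast_eq_natCast_iff _ _ _).2 this
  refine ⟨fun x => (j x : ZMod p), continuous_of_window (L + 1) fun x y hxy => ?_, fun r => ?_,
    hcomm⟩
  · refine (ZMod.natCast_eq_natCast_iff _ _ _).2 (hL _ _ fun i hi => ?_)
    rw [← hj x i (by omega), ← hj y i (by omega), hxy i (by omega)]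
  · obtain ⟨x⟩ := nonempty_subshift hq a
    have hit : ∀ n : ℕ, (j ((shift q a)^[n] x) : ZMod p) = (j x : ZMod p) + n := by
      intro n
      induction n with
      | zero => simp
      | succ n ih => rw [Function.iterate_succ_apply', hcomm, ih]; push_cast; ring
    refine ⟨(shift q a)^[(r - (j x : ZMod p)).val] x, ?_⟩
    simp only [hit, ZMod.natCast_val, ZMod.cast_id', id_eq]
    ring

/-- Arbitrarily long runs of ones in `V` give a fixed point of the shift. -/
theorem exists_fixed (hq : ∀ n, 1 < q n) (hb : ¬ BoundedSpacers q a) :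
    ∃ x : Subshift q a, shift q a x = x := by
  refine ⟨⟨fun _ => 1, fun k l => ?_⟩, rfl⟩
  simp only [BoundedSpacers, not_exists, not_forall, not_le] at hb
  obtain ⟨m, i, h1, h2, h⟩ := hb l
  have hg := gap_mul hq a h1 h2
  obtain ⟨k, hk⟩ : ∃ k, zeroCount q m * i = k + 1 :=
    Nat.exists_eq_add_of_le' (Nat.mul_pos (zeroCount_pos hq m) h1)
  refine ⟨zeroPos (gap q a) k + 1, fun t ht => ?_⟩
  have hne : infiniteWord q a (zeroPos (gap q a) k + 1 + t) ≠ 0 := by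
    rw [Ne, infiniteWord_eq_zero_iff hq]
    rintro ⟨r, hr⟩
    have hs : zeroPos (gap q a) (k + 1) = zeroPos (gap q a) k + 1 + gap q a (k + 1) := rfl
    rw [← hk, hg] at hs
    have hm := zeroPos_strictMono (gap q a)
    rcases le_or_gt r k with h' | h'
    · have := hm.monotone h'
      omega
    · have := hm.monotone (Nat.succ_le_of_lt h')
      rw [Nat.succ_eq_add_one, ← hk] at this
      omega
  exact (Fin.eq_one_of_ne_zero _ hne).symm

end Topology

/-! ### The largest admissible divisor -/

section Dividing

theorem dividesLengths_iff {q : ℕ → ℕ} (hq : ∀ n, 1 < q n) {a : ℕ → ℕ → ℕ}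
    {p : ℕ} : DividesLengths q a p ↔
    ∃ n, ∀ j, 1 ≤ j → p ∣ (genWord q a n).length + gap q a (zeroCount q n * j) :=
  exists_congr fun _ => dvd_length_iff hq a

theorem DividesLengths.lcm {q : ℕ → ℕ} (hq : ∀ n, 1 < q n) {a : ℕ → ℕ → ℕ}
    {p p' : ℕ} (h : DividesLengths q a p) (h' : DividesLengths q a p') :
    DividesLengths q a (p.lcm p') := by
  rw [dividesLengths_iff hq] at *
  obtain ⟨n, hn⟩ := h
  obtain ⟨n', hn'⟩ := h'
  exact ⟨max n n', fun j hj => Nat.lcm_dvd (dvd_length_mono hq a (le_max_left _ _) hn j hj)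
    (dvd_length_mono hq a (le_max_right _ _) hn' j hj)⟩

/-- `p` divides the positive difference of two distinct spacers, which is at most `B`. -/
theorem DividesLengths.le {q : ℕ → ℕ} (hq : ∀ n, 1 < q n) {a : ℕ → ℕ → ℕ}
    {B : ℕ} (hX : Infinite (Subshift q a))
    (hB : ∀ n i, 1 ≤ i → i < q n → a n i ≤ B) {p : ℕ} (h : DividesLengths q a p) : p ≤ B := by
  rw [dividesLengths_iff hq] at h
  obtain ⟨n, hn⟩ := h
  obtain ⟨j₁, j₂, h1, h2, hne⟩ := exists_gap_ne hq a hX n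
  wlog hlt : gap q a (zeroCount q n * j₁) < gap q a (zeroCount q n * j₂) generalizing j₁ j₂
  · exact this j₂ j₁ h2 h1 hne.symm (by omega)
  have := gap_le hq hB (Nat.mul_pos (zeroCount_pos hq n) h2)
  have hd := Nat.dvd_sub (hn j₂ h2) (hn j₁ h1)
  exact (Nat.le_of_dvd (by omega) hd).trans (by omega)

theorem exists_isGreatest_dividesLengths {q : ℕ → ℕ} (hq : ∀ n, 1 < q n) {a : ℕ → ℕ → ℕ}
    (hX : Infinite (Subshift q a))
    (hb : BoundedSpacers q a) : ∃ p, IsGreatest {p | DividesLengths q a p} p ∧ 0 < p ∧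
      ∀ p', DividesLengths q a p' → p' ∣ p := by
  obtain ⟨B, hB⟩ := hb
  have hbdd : BddAbove {p | DividesLengths q a p} :=
    ⟨B, fun p hp => DividesLengths.le hq hX hB hp⟩
  have h1 : DividesLengths q a 1 := ⟨0, fun _ _ _ _ _ => one_dvd _⟩
  have hg : IsGreatest {p | DividesLengths q a p} (sSup {p | DividesLengths q a p}) :=
    ⟨Nat.sSup_mem ⟨1, h1⟩ hbdd, fun p hp => le_csSup hbdd hp⟩
  have hpos : 0 < sSup {p | DividesLengths q a p} := hg.2 h1
  refine ⟨_, hg, hpos, fun p' hp' => ?_⟩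
  -- Closure under lcm turns the maximum into a common multiple. The lcm is nonzero because 0 cannot
  -- divide the positive number |v_n| + spacer.
  have hl := hg.2 (DividesLengths.lcm hq hg.1 hp')
  refine (Nat.dvd_lcm_right _ _).trans (Nat.le_antisymm hl
    (Nat.le_of_dvd (Nat.pos_of_ne_zero fun h0 => ?_) (Nat.dvd_lcm_left _ _))).dvd
  · have h2 := DividesLengths.lcm hq hg.1 hp'
    rw [h0] at h2
    obtain ⟨n, hn⟩ := (dividesLengths_iff hq).1 h2
    have := zero_dvd_iff.1 (hn 1 le_rfl)
    have := lt_length_genWord q a hq n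
    omega

end Dividing

/-! ### Periods of equicontinuous factors -/

section Equicontinuous

theorem isEquicontinuous_of_finite {Y : Type*} [TopologicalSpace Y] [Finite Y]
    [TopologicalSpace.MetrizableSpace Y] {S : Y → Y} (hS : Function.Bijective S) :
    IsEquicontinuous S := by
  refine ⟨⟨Equiv.ofBijective S hS, continuous_of_discreteTopology,
    continuous_of_discreteTopology⟩, fun _ => rfl, TopologicalSpace.metrizableSpaceMetric Y, rfl,
    fun ε hε => ?_⟩
  let := TopologicalSpace.metrizableSpaceMetric Y
  classical
  rcases isEmpty_or_nonempty Y with h | h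
  · exact ⟨1, one_pos, fun y => h.elim y⟩
  obtain ⟨z, hz⟩ := Finite.exists_min fun z : Y × Y => if z.1 = z.2 then (1 : ℝ) else dist z.1 z.2
  refine ⟨if z.1 = z.2 then (1 : ℝ) else dist z.1 z.2, ?_, fun y₁ y₂ h l => ?_⟩
  · split_ifs with h
    · exact one_pos
    · exact dist_pos.2 h
  · have h1 := hz (y₁, y₂)
    have : y₁ = y₂ := by
      by_contra hne
      simp only [hne, if_false] at h1
      exact absurd h (not_lt.2 h1)
    subst this
    change dist _ _ < ε
    rwa [dist_self]

/-- A finite sequence of points has a positive distance from the point `y` where it differs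
from `y`. -/
theorem exists_pos_isolated {Y : Type*} [MetricSpace Y] (y : Y) (f : ℕ → Y) (R : ℕ) :
    ∃ ε > 0, ∀ r ≤ R, dist y (f r) < ε → f r = y := by
  have hfin : ((f '' Set.Iic R) \ {y}).Finite := ((Set.finite_Iic R).image f).subset Set.sdiff_subset
  obtain ⟨ε, hε, h⟩ := Metric.isOpen_iff.1 hfin.isClosed.isOpen_compl y (by simp)
  refine ⟨ε, hε, fun r hr hd => ?_⟩
  by_contra hne
  exact h (Metric.mem_ball'.2 hd) ⟨Set.mem_image_of_mem f hr, hne⟩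

theorem zpow_orbit {q : ℕ → ℕ} {a : ℕ → ℕ → ℕ}
    {Y : Type*} [MetricSpace Y]
    {S : Y → Y} {φ : Subshift q a → Y} {e : Y ≃ₜ Y} {x : ℤ → Subshift q a}
    (hφ : IsFactorMap (shift q a) S φ) (he : ∀ y, e y = S y)
    (hx : ∀ k i, (x k).1 i = (x 0).1 (k + i)) (k l : ℤ) : (e ^ l) (φ (x k)) = φ (x (k + l)) := by
  have h1 : ∀ k, e (φ (x k)) = φ (x (k + 1)) := fun k => by
    rw [he, ← hφ.comm, shift_orbit hx]
  induction l with
  | zero => simp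
  | succ l ih => rw [add_comm (l : ℤ) 1, zpow_add, Homeomorph.mul_apply, ih, zpow_one, h1]; ring_nf
  | pred l ih =>
    rw [sub_eq_neg_add, zpow_add, Homeomorph.mul_apply, ih, zpow_neg_one]
    refine e.injective ?_
    rw [h1]
    exact (e.apply_symm_apply _).trans (by ring_nf)

/-- The lengths of the spaced blocks are approximate periods of equicontinuous factors. -/
theorem exists_approx_period {q : ℕ → ℕ} (hq : ∀ n, 1 < q n) {a : ℕ → ℕ → ℕ}
    {Y : Type*} [MetricSpace Y]
    {S : Y → Y} {φ : Subshift q a → Y} {e : Y ≃ₜ Y} {x : ℤ → Subshift q a} {c : ℕ → ℕ}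
    (hφ : IsFactorMap (shift q a) S φ) (he : ∀ y, e y = S y)
    (heq : ∀ ε : ℝ, 0 < ε → ∃ δ : ℝ, 0 < δ ∧ ∀ y₁ y₂ : Y, dist y₁ y₂ < δ →
      ∀ l : ℤ, dist ((e ^ l) y₁) ((e ^ l) y₂) < ε) (hc : StrictMono c)
    (hx : ∀ k i, (x k).1 i = (x 0).1 (k + i))
    (hV : ∀ n i, i ≤ 2 * c n → (x 0).1 ((i : ℤ) - c n) = infiniteWord q a i)
    {ε : ℝ} (hε : 0 < ε) : ∃ N, ∀ n, N ≤ n → ∀ j, 1 ≤ j →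
      dist (φ (x 0)) (φ (x ((genWord q a n).length + gap q a (zeroCount q n * j) : ℕ))) < ε := by
  obtain ⟨δ, hδ, hd⟩ := heq ε hε
  obtain ⟨m, hm⟩ := exists_window (Metric.isOpen_ball.preimage hφ.continuous)
    (show x 0 ∈ φ ⁻¹' Metric.ball (φ (x 0)) (δ / 2) by simpa using hδ)
  have hmc : m ≤ c m := hc.le_apply
  -- Then v_n is longer than `2 * c m`, so each copy of it begins with the window of `x 0` of radius
  -- `c m`.
  refine ⟨2 * c m, fun n hn j hj => ?_⟩
  have hlen := lt_length_genWord q a hq n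
  obtain ⟨j, rfl⟩ := Nat.exists_eq_add_of_le' hj
  have hpos := zeroPos_mul_succ hq a n j
  obtain ⟨M, hM⟩ : ∃ M, zeroPos (gap q a) (zeroCount q n * (j + 1)) + 2 * c m ≤ c M :=
    ⟨_, hc.le_apply⟩
  -- The orbit point centred `c m` places into copy number `t` of v_n looks like `x 0`; `- c M`
  -- converts positions in V to orbit times.
  have key : ∀ t, t ≤ j + 1 → dist (φ (x (zeroPos (gap q a) (zeroCount q n * t) - c M + c m)))
      (φ (x 0)) < δ / 2 := by
    intro t ht
    have hle := (zeroPos_strictMono (gap q a)).monotone (Nat.mul_le_mul_left (zeroCount q n) ht)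
    refine hm _ fun i hi => ?_
    have h1 := hV M (zeroPos (gap q a) (zeroCount q n * t) + (c m + i).toNat) (by omega)
    rw [infiniteWord_block hq a n t (by omega), ← hV m _ (by omega)] at h1
    rw [hx]
    convert h1 using 2 <;> omega
  have h := hd _ _ ((dist_triangle_right _ _ _).trans_lt
    (add_lt_add (key j (by omega)) (key (j + 1) le_rfl)) |>.trans_eq (add_halves δ))
    (-(zeroPos (gap q a) (zeroCount q n * j) - c M + c m))
  rw [zpow_orbit hφ he hx, zpow_orbit hφ he hx, hpos] at h
  convert h using 4
  · ring
  · push_cast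
    ring

/-- Boundedness enters by confining the differences of spacers to a finite set, on which an
approximate return is an exact one. -/
theorem exists_period {q : ℕ → ℕ} (hq : ∀ n, 1 < q n) {a : ℕ → ℕ → ℕ}
    {Y : Type*} [MetricSpace Y]
    {S : Y → Y} {φ : Subshift q a → Y} {e : Y ≃ₜ Y} {x : ℤ → Subshift q a} {c : ℕ → ℕ}
    (hX : Infinite (Subshift q a)) (hb : BoundedSpacers q a)
    (hφ : IsFactorMap (shift q a) S φ) (he : ∀ y, e y = S y)
    (heq : ∀ ε : ℝ, 0 < ε → ∃ δ : ℝ, 0 < δ ∧ ∀ y₁ y₂ : Y, dist y₁ y₂ < δ →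
      ∀ l : ℤ, dist ((e ^ l) y₁) ((e ^ l) y₂) < ε) (hc : StrictMono c)
    (hx : ∀ k i, (x k).1 i = (x 0).1 (k + i))
    (hV : ∀ n i, i ≤ 2 * c n → (x 0).1 ((i : ℤ) - c n) = infiniteWord q a i) :
    ∃ p, DividesLengths q a p ∧ S^[p] (φ (x 0)) = φ (x 0) := by
  obtain ⟨B, hB⟩ := hb
  have hit : ∀ k : ℕ, S^[k] (φ (x 0)) = φ (x k) := by
    intro k
    induction k with
    | zero => rfl
    | succ k ih => rw [Function.iterate_succ_apply', ih, ← hφ.comm, shift_orbit hx]; push_cast; rfl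
  obtain ⟨D, hD, hDper⟩ : ∃ D : ℕ, 0 < D ∧ φ (x D) = φ (x 0) := by
    obtain ⟨ε, hε, hiso⟩ := exists_pos_isolated (φ (x 0)) (fun r : ℕ => φ (x r)) B
    obtain ⟨δ, hδ, hd⟩ := heq ε hε
    obtain ⟨N, hN⟩ := exists_approx_period hq hφ he heq hc hx hV (half_pos hδ)
    obtain ⟨j₁, j₂, h1, h2, hne⟩ := exists_gap_ne hq a hX N
    wlog hlt : gap q a (zeroCount q N * j₁) < gap q a (zeroCount q N * j₂) generalizing j₁ j₂
    · exact this j₂ j₁ h2 h1 hne.symm (by omega)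
    have hle := gap_le hq hB (Nat.mul_pos (zeroCount_pos hq N) h2)
    refine ⟨gap q a (zeroCount q N * j₂) - gap q a (zeroCount q N * j₁), by omega,
      hiso _ (by omega) ?_⟩
    -- Two approximate returns are close to each other; moving back by the shorter time compares `x
    -- 0` with `x D`, `D` being the difference of the gaps.
    have h := hd _ _ ((dist_triangle_left _ _ _).trans_lt
      (add_lt_add (hN N le_rfl j₁ h1) (hN N le_rfl j₂ h2)) |>.trans_eq (add_halves δ))
      (-((genWord q a N).length + gap q a (zeroCount q N * j₁) : ℕ))
    rw [zpow_orbit hφ he hx, zpow_orbit hφ he hx] at h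
    convert h using 4 <;> omega
  have hper : Function.IsPeriodicPt S D (φ (x 0)) := (hit D).trans hDper
  refine ⟨Function.minimalPeriod S (φ (x 0)), ?_, Function.isPeriodicPt_minimalPeriod _ _⟩
  have hp := hper.minimalPeriod_pos hD
  -- This `ε` separates the base point from the rest of its finite orbit.
  obtain ⟨ε, hε, hiso⟩ := exists_pos_isolated (φ (x 0)) (fun r : ℕ => φ (x r))
    (Function.minimalPeriod S (φ (x 0)))
  obtain ⟨N, hN⟩ := exists_approx_period hq hφ he heq hc hx hV hε
  refine (dividesLengths_iff hq).2 ⟨N, fun j hj => ?_⟩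
  have h := hN N le_rfl j hj
  rw [← hit, ← Function.iterate_mod_minimalPeriod_eq, hit] at h
  have h2 := hiso _ (Nat.mod_lt _ hp).le h
  simp only [← hit] at h2
  exact (Nat.dvd_mod_iff dvd_rfl).1 (Function.IsPeriodicPt.minimalPeriod_dvd h2)

/-- A fixed point in the subshift forces equicontinuous factors to be trivial. -/
theorem subsingleton_of_fixed {q : ℕ → ℕ} {a : ℕ → ℕ → ℕ}
    {Y : Type*} [MetricSpace Y]
    {S : Y → Y} {φ : Subshift q a → Y} {e : Y ≃ₜ Y} {x : ℤ → Subshift q a} {c : ℕ → ℕ}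
    (hφ : IsFactorMap (shift q a) S φ) (he : ∀ y, e y = S y)
    (heq : ∀ ε : ℝ, 0 < ε → ∃ δ : ℝ, 0 < δ ∧ ∀ y₁ y₂ : Y, dist y₁ y₂ < δ →
      ∀ l : ℤ, dist ((e ^ l) y₁) ((e ^ l) y₂) < ε) (hc : StrictMono c)
    (hx : ∀ k i, (x k).1 i = (x 0).1 (k + i))
    (hV : ∀ n i, i ≤ 2 * c n → (x 0).1 ((i : ℤ) - c n) = infiniteWord q a i)
    {z : Subshift q a} (hz : shift q a z = z) : Subsingleton Y := by
  have hdense := denseRange_orbit hc hx hV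
  have hfix : ∀ l : ℤ, (e ^ l) (φ z) = φ z := by
    have h1 : e (φ z) = φ z := by rw [he, ← hφ.comm, hz]
    intro l
    induction l with
    | zero => simp
    | succ l ih => rw [zpow_add, Homeomorph.mul_apply, zpow_one, h1, ih]
    | pred l ih =>
      rw [sub_eq_add_neg, zpow_add, Homeomorph.mul_apply, zpow_neg_one]
      nth_rewrite 1 [← h1]
      exact (congrArg _ (e.symm_apply_apply _)).trans ih
  have hconst : ∀ k, φ (x k) = φ z := by
    intro k
    refine eq_of_forall_dist_le fun ε hε => ?_
    obtain ⟨δ, hδ, hd⟩ := heq ε hε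
    obtain ⟨m, hm⟩ := hdense.exists_mem_open (Metric.isOpen_ball.preimage hφ.continuous)
      ⟨z, show z ∈ φ ⁻¹' Metric.ball (φ z) δ by simpa using hδ⟩
    have h := hd _ _ hm (k - m)
    rw [zpow_orbit hφ he hx, hfix] at h
    simpa using h.le
  have hall : φ = fun _ => φ z := hdense.equalizer hφ.continuous continuous_const (funext hconst)
  refine ⟨fun y y' => ?_⟩
  obtain ⟨w, rfl⟩ := hφ.surjective y
  obtain ⟨w', rfl⟩ := hφ.surjective y'
  exact (congrFun hall w).trans (congrFun hall w').symm

end Equicontinuous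


/-! ### Maximal equicontinuous and largest finite factors -/

section Factors

theorem subsingleton_of_unbounded {q : ℕ → ℕ} (hq : ∀ n, 1 < q n) {a : ℕ → ℕ → ℕ}
    (hb : ¬ BoundedSpacers q a) {Y : Type*} [TopologicalSpace Y]
    {S : Y → Y} {ψ : Subshift q a → Y} (hS : IsEquicontinuous S)
    (hψ : IsFactorMap (shift q a) S ψ) : Subsingleton Y := by
  obtain ⟨e, he, d, hd, heq⟩ := hS
  subst hd
  obtain ⟨x, c, hc, hx, hV⟩ := exists_orbit hq a
  obtain ⟨z, hz⟩ := exists_fixed hq hb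
  exact subsingleton_of_fixed hψ he heq hc hx hV hz

theorem isMaximal_unit {q : ℕ → ℕ} (hq : ∀ n, 1 < q n) {a : ℕ → ℕ → ℕ}
    (hb : ¬ BoundedSpacers q a) :
    IsMaximalEquicontinuousFactor.{0, 0, w} (shift q a) (id : Unit → Unit) := by
  obtain ⟨z⟩ := nonempty_subshift hq a
  refine ⟨⟨inferInstance, inferInstance, continuous_id⟩,
    isEquicontinuous_of_finite Function.bijective_id,
    fun _ => (), ⟨continuous_const, fun _ => ⟨z, rfl⟩, fun _ => rfl⟩,
    fun Y _ S ψ _ hS hψ => ?_⟩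
  have := subsingleton_of_unbounded hq hb hS hψ
  exact ⟨fun _ => ψ z, ⟨continuous_const, fun y => ⟨(), Subsingleton.elim _ _⟩,
    fun _ => Subsingleton.elim _ _⟩, fun _ => Subsingleton.elim _ _⟩

/-- Along the base orbit both maps depend only on time mod `p`, and `φ` determines that time. This
defines `θ`, and density extends the identity to all points. -/
theorem exists_factor_of_cyclic {q : ℕ → ℕ} (hq : ∀ n, 1 < q n) {a : ℕ → ℕ → ℕ}
    (hX : Infinite (Subshift q a)) (hb : BoundedSpacers q a)
    {p : ℕ} [NeZero p] (hp : ∀ p', DividesLengths q a p' → p' ∣ p)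
    {φ : Subshift q a → ZMod p} (hφ : IsFactorMap (shift q a) (cyclicMap p) φ)
    {Y : Type*} [TopologicalSpace Y] {S : Y → Y} {ψ : Subshift q a → Y}
    (hS : IsEquicontinuous S) (hψ : IsFactorMap (shift q a) S ψ) :
    ∃ θ : ZMod p → Y, IsFactorMap (cyclicMap p) S θ ∧ ∀ x, θ (φ x) = ψ x := by
  obtain ⟨e, he, d, hd, heq⟩ := hS
  subst hd
  obtain ⟨x, c, hc, hx, hV⟩ := exists_orbit hq a
  obtain ⟨p', hp', hper⟩ := exists_period hq hX hb hψ he heq hc hx hV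
  have hit : ∀ k : ℕ, S^[k] (ψ (x 0)) = ψ (x k) := by
    intro k
    induction k with
    | zero => rfl
    | succ k ih => rw [Function.iterate_succ_apply', ih, ← hψ.comm, shift_orbit hx]; push_cast; rfl
  have hperp : ψ (x p) = ψ (x 0) := by
    rw [← hit]
    exact Function.IsPeriodicPt.trans_dvd hper (hp p' hp')
  have hperZ : Function.Periodic (fun k : ℤ => ψ (x k)) p := fun k => by
    have h := congrArg (e ^ k) hperp
    rw [zpow_orbit hψ he hx, zpow_orbit hψ he hx, zero_add] at h
    rw [add_comm]
    exact h
  have hφx : ∀ k : ℤ, φ (x k) = φ (x 0) + k := by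
    intro k
    induction k with
    | zero => simp
    | succ k ih =>
      rw [← shift_orbit hx, hφ.comm, ih, cyclicMap]
      push_cast
      ring
    | pred k ih =>
      have h := hφ.comm (x (-(k : ℤ) - 1))
      rw [shift_orbit hx, sub_add_cancel, ih, cyclicMap] at h
      rw [← sub_eq_iff_eq_add] at h
      rw [← h]
      push_cast
      ring
  have key : (fun z => S^[(φ z - φ (x 0)).val] (ψ (x 0))) = ψ := by
    refine (denseRange_orbit hc hx hV).equalizer ?_ hψ.continuous (funext fun k => ?_)
    · exact (continuous_of_discreteTopology
        (f := fun r : ZMod p => S^[(r - φ (x 0)).val] (ψ (x 0)))).comp hφ.continuous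
    · simp only [Function.comp_apply]
      rw [hφx, add_sub_cancel_left, hit, ZMod.val_intCast, Int.emod_def, mul_comm]
      exact hperZ.sub_int_mul_eq _
  refine ⟨fun r => S^[(r - φ (x 0)).val] (ψ (x 0)), ⟨continuous_of_discreteTopology, fun y => ?_,
    fun r => ?_⟩, congrFun key⟩
  · obtain ⟨z, rfl⟩ := hψ.surjective y
    exact ⟨φ z, congrFun key z⟩
  · obtain ⟨z, rfl⟩ := hφ.surjective r
    rw [← hφ.comm]
    refine (congrFun key _).trans ((hψ.comm z).trans ?_)
    exact congrArg S (congrFun key z).symm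

theorem isMaximal_cyclicMap {q : ℕ → ℕ} (hq : ∀ n, 1 < q n) {a : ℕ → ℕ → ℕ}
    (hX : Infinite (Subshift q a)) (hb : BoundedSpacers q a)
    {p : ℕ} (hp0 : 0 < p) (hpd : DividesLengths q a p)
    (hp : ∀ p', DividesLengths q a p' → p' ∣ p) :
    IsMaximalEquicontinuousFactor.{0, 0, w} (shift q a) (cyclicMap p) := by
  have : NeZero p := ⟨hp0.ne'⟩
  obtain ⟨φ, hφ⟩ := isFactor_cyclicMap hq hX hb hpd
  exact ⟨⟨inferInstance, inferInstance, continuous_of_discreteTopology⟩,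
    isEquicontinuous_of_finite (Equiv.addRight (1 : ZMod p)).bijective, φ, hφ,
    fun Y _ S ψ _ hS hψ => exists_factor_of_cyclic hq hX hb hp hφ hS hψ⟩

/-- The shift is onto, hence so is `S`, which on a finite set makes it bijective. -/
theorem isEquicontinuous_of_finite_factor {q : ℕ → ℕ} {a : ℕ → ℕ → ℕ}
    {Y : Type*} [TopologicalSpace Y] [Finite Y] {S : Y → Y}
    (hS : IsSystem S) (h : IsFactor (shift q a) S) : IsEquicontinuous S := by
  obtain ⟨ψ, hψ⟩ := h
  have := hS.metrizable
  refine isEquicontinuous_of_finite (Finite.surjective_iff_bijective.1 fun y => ?_)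
  obtain ⟨z, hz⟩ := (hψ.surjective.comp (shift_surjective q a)) y
  exact ⟨ψ z, by rw [← hψ.comm]; exact hz⟩

theorem IsMaximalEquicontinuousFactor.isLargestFiniteFactor {q : ℕ → ℕ} {a : ℕ → ℕ → ℕ}
    {Y : Type v} [TopologicalSpace Y]
    [Finite Y] {S : Y → Y}
    (h : IsMaximalEquicontinuousFactor.{0, v, w} (shift q a) S) :
    IsLargestFiniteFactor.{0, v, w} (shift q a) S := by
  obtain ⟨hsys, -, φ, hφ, hmax⟩ := h
  refine ⟨hsys, inferInstance, ⟨φ, hφ⟩, fun Y' _ S' hS' _ ⟨ψ, hψ⟩ => ?_⟩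
  obtain ⟨θ, hθ, -⟩ := hmax Y' S' ψ hS' (isEquicontinuous_of_finite_factor hS' ⟨ψ, hψ⟩) hψ
  exact ⟨θ, hθ⟩

/-- The sizes of finite cyclic factors are bounded. -/
theorem exists_bound_cyclic_factor {q : ℕ → ℕ} (hq : ∀ n, 1 < q n) {a : ℕ → ℕ → ℕ}
    (hX : Infinite (Subshift q a)) :
    ∃ C, ∀ p, 0 < p → IsFactor (shift q a) (cyclicMap p) → p ≤ C := by
  obtain ⟨Y, _, _, S, hS⟩ : ∃ (Y : Type) (_ : TopologicalSpace Y) (_ : Finite Y) (S : Y → Y),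
      IsLargestFiniteFactor.{0, 0, 0} (shift q a) S := by
    by_cases hb : BoundedSpacers q a
    · obtain ⟨p, hg, hp0, hp⟩ := exists_isGreatest_dividesLengths hq hX hb
      have : NeZero p := ⟨hp0.ne'⟩
      exact ⟨ZMod p, _, inferInstance, _,
        (isMaximal_cyclicMap hq hX hb hp0 hg.1 hp).isLargestFiniteFactor⟩
    · exact ⟨Unit, _, inferInstance, _, (isMaximal_unit hq hb).isLargestFiniteFactor⟩
  refine ⟨Nat.card Y, fun p hp0 h => ?_⟩
  have : NeZero p := ⟨hp0.ne'⟩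
  obtain ⟨θ, hθ⟩ := hS.2.2.2 (ZMod p) (cyclicMap p)
    ⟨inferInstance, inferInstance, continuous_of_discreteTopology⟩ inferInstance h
  simpa using Nat.card_le_card_of_surjective θ hθ.surjective

end Factors

/-! ### Odometers with bounded periods are finite -/

section Odometers

theorem isFactorMap_odometer (s : ℕ → ℕ) (hs : ∀ k, s k ∣ s (k + 1)) (hpos : ∀ k, 0 < s k)
    (k : ℕ) : IsFactorMap (odometerMap s hs) (cyclicMap (s k)) fun x => x.1 k := by
  refine ⟨(continuous_apply k).comp continuous_subtype_val, fun r => ?_, fun _ => rfl⟩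
  have : NeZero (s k) := ⟨(hpos k).ne'⟩
  exact ⟨⟨fun i => (r.val : ZMod (s i)), fun i => map_natCast _ _⟩, ZMod.natCast_zmod_val r⟩

theorem castHom_injective_of_eq {m n : ℕ} (h : n ∣ m) (hmn : m = n) :
    Function.Injective (ZMod.castHom h (ZMod n)) := by
  subst hmn
  rw [ZMod.castHom_self]
  exact Function.injective_id

theorem finite_odometer (s : ℕ → ℕ) (hs : ∀ k, s k ∣ s (k + 1)) (hpos : ∀ k, 0 < s k) {C : ℕ}
    (hC : ∀ k, s k ≤ C) : Finite (Odometer s hs) := by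
  have hmono : Monotone s := monotone_nat_of_le_succ fun k => Nat.le_of_dvd (hpos _) (hs k)
  have hbdd : BddAbove (Set.range s) := ⟨C, Set.forall_mem_range.2 hC⟩
  -- From `K` on the sequence `s` is constant and the bonding maps are injective, so coordinate `K`
  -- determines the whole point.
  obtain ⟨K, hK⟩ := Nat.sSup_mem (Set.range_nonempty s) hbdd
  have hle : ∀ k, s k ≤ s K := fun k => hK ▸ le_csSup hbdd (Set.mem_range_self k)
  have : NeZero (s K) := ⟨(hpos K).ne'⟩
  refine Finite.of_injective (fun x : Odometer s hs => x.1 K) fun x y hxy => ?_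
  have hup : ∀ k, K ≤ k → x.1 k = y.1 k := by
    intro k hk
    induction k, hk using Nat.le_induction with
    | base => exact hxy
    | succ k hk ih =>
      refine castHom_injective_of_eq (hs k) (le_antisymm ((hle _).trans (hmono hk))
        (hmono k.le_succ)) ?_
      rw [x.2 k, y.2 k, ih]
  refine Subtype.ext (funext fun k => ?_)
  have hdown : ∀ d, x.1 (k + d) = y.1 (k + d) → x.1 k = y.1 k := by
    intro d
    induction d with
    | zero => exact id
    | succ d ih =>
      intro h
      refine ih ?_
      rw [← x.2 (k + d), ← y.2 (k + d)]
      exact congrArg _ h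
  exact hdown K (hup _ (Nat.le_add_left K k))

theorem IsFactorMap.comp {X Y Z : Type*} [TopologicalSpace X] [TopologicalSpace Y]
    [TopologicalSpace Z] {T : X → X} {S : Y → Y} {R : Z → Z} {ψ : Y → Z} {φ : X → Y}
    (hψ : IsFactorMap S R ψ) (hφ : IsFactorMap T S φ) : IsFactorMap T R (ψ ∘ φ) :=
  ⟨hψ.continuous.comp hφ.continuous, hψ.surjective.comp hφ.surjective, fun x => by
    rw [Function.comp_apply, hφ.comm, hψ.comm, Function.comp_apply]⟩

end Odometers

end RankOne

theorem mainTheorem1 (q : ℕ → ℕ) (a : ℕ → ℕ → ℕ) (hq : ∀ n, 1 < q n)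
    (hX : Infinite (RankOne.Subshift q a)) :
    (¬ RankOne.BoundedSpacers q a →
      RankOne.IsMaximalEquicontinuousFactor.{0, 0, w} (RankOne.shift q a) (id : Unit → Unit)) ∧
    (RankOne.BoundedSpacers q a →
      ∃ pmax : ℕ, IsGreatest {p : ℕ | RankOne.DividesLengths q a p} pmax ∧
        RankOne.IsMaximalEquicontinuousFactor.{0, 0, w}
          (RankOne.shift q a) (RankOne.cyclicMap pmax) ∧
        RankOne.IsLargestFiniteFactor.{0, 0, w}
          (RankOne.shift q a) (RankOne.cyclicMap pmax)) ∧
    (∀ (s : ℕ → ℕ) (hs : ∀ k, s k ∣ s (k + 1)), (∀ k, 0 < s k) →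
      Infinite (RankOne.Odometer s hs) →
        ¬ RankOne.IsFactor (RankOne.shift q a) (RankOne.odometerMap s hs)) := by
  refine ⟨RankOne.isMaximal_unit hq, fun hb => ?_, fun s hs hpos hinf ⟨φ, hφ⟩ => ?_⟩
  · obtain ⟨p, hg, hp0, hp⟩ := RankOne.exists_isGreatest_dividesLengths hq hX hb
    have : NeZero p := ⟨hp0.ne'⟩
    have hmax := RankOne.isMaximal_cyclicMap.{w} hq hX hb hp0 hg.1 hp
    exact ⟨p, hg, hmax, hmax.isLargestFiniteFactor⟩
  · obtain ⟨C, hC⟩ := RankOne.exists_bound_cyclic_factor hq hX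
    have := RankOne.finite_odometer s hs hpos fun k =>
      hC _ (hpos k) ⟨_, (RankOne.isFactorMap_odometer s hs hpos k).comp hφ⟩
    exact not_finite (RankOne.Odometer s hs)
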